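/- A substitution over a finite alphabet $A$ is a map $\tau$ from $A$ to the non-empty finite words over $A$; it extends to a homomorphism of words by concatenation, and $\tau^t$ denotes its $t$-th power. It is called Toeplitz if it is injective, all images $\tau(a)$ have the same length, this length is at least $2$, and all images start with the same letter. Its limit set $\Omega_\tau\subseteq A^{\mathbb Z}$ is the set of configurations $x$ such that for every $t\in\mathbb N$ there are $y\in A^{\mathbb Z}$ and a strictly increasing sequence of integers $(k_s)_{s\in\mathbb Z}$ with $x_{k_s}x_{k_s+1}\cdots x_{k_{s+1}-1}=\tau^t(y_s)$ for all $s\in\mathbb Z$. The substitutive shift of $\tau$ is the set of configurations all of whose finite factors occur in some word $\tau^t(a)$, $t\in\mathbb N$, $a\in A$. The shift map is $\sigma(x)_i=x_{i+1}$. A continuous self-map $f$ of a metric space $(X,d)$ is positively $n$-expansive if there is $\varepsilon>0$ such that for every $x\in X$ the set $\{y\in X:\ d(f^t(x),f^t(y))<\varepsilon\ \text{for all } t\in\mathbb N\}$ has at most $n$ elements. **Proposition.** For each $n\ge 2$ there is a minimal substitutive Toeplitz shift over the $n$-letter alphabet $\{0,\dots,n-1\}$ that is positively $n$-expansive but not positively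 $(n-1)$-expansive. Explicitly, let $\tau$ be the substitution $\tau(k)=0\,1\cdots(n-1)\,k$ for $0\le k\le n-1$. Then $\tau$ is a Toeplitz substitution; its limit set $\Omega_\tau$ is a closed shift-invariant subset of $\{0,\dots,n-1\}^{\mathbb Z}$ and coincides with the substitutive shift of $\tau$; the system $(\Omega_\tau,\sigma)$ is minimal, that is, $\Omega_\tau$ is nonempty and every forward orbit $\{\sigma^k(x):k\in\mathbb N\}$ is dense in $\Omega_\tau$; and, for every metric on $\Omega_\tau$ inducing the product topology, $(\Omega_\tau,\sigma)$ is positively $n$-expansive and not positively $(n-1)$-expansive. -/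

import Mathlib

namespace SubstShift

/-! ### Positive `n`-expansiveness and minimality of a dynamical system -/

/-- The set `W_ε(x)` of points whose forward orbit stays `ε`-close to the forward orbit of `x`. -/
def dynBall {X : Type*} [MetricSpace X] (f : X → X) (ε : ℝ) (x : X) : Set X :=
  {y | ∀ t : ℕ, dist (f^[t] x) (f^[t] y) < ε}

/-- `(X, f)` is positively `n`-expansive: for some `ε > 0`, every `W_ε(x)` has at most `n`
elements. -/
def IsPositivelyExpansive {X : Type*} [MetricSpace X] (n : ℕ) (f : X → X) : Prop :=
  ∃ ε : ℝ, 0 < ε ∧ ∀ x : X, (dynBall f ε x).encard ≤ n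

/-- `(X, f)` is minimal: `X` is nonempty and every forward orbit is dense. -/
def IsMinimalSystem {X : Type*} [TopologicalSpace X] (f : X → X) : Prop :=
  Nonempty X ∧ ∀ x : X, Dense (Set.range fun k : ℕ => f^[k] x)

/-- The shift action `σ(x)_i = x_{i+1}`, restricted to a `ℤ`-shift. -/
def shiftMap {A : Type*} [TopologicalSpace A] (X : SymbolicDynamics.FullShift.Subshift A ℤ) :
    X.carrier → X.carrier :=
  Set.MapsTo.restrict (SymbolicDynamics.FullShift.shift (1 : ℤ)) X.carrier X.carrier (X.mapsTo 1)

/-! ### Substitutions -/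

/-- The factor `x_i x_{i+1} ⋯ x_{j-1}` of a configuration. -/
def word {A : Type*} (x : ℤ → A) (i j : ℤ) : List A :=
  List.ofFn fun m : Fin (j - i).toNat => x (i + (m : ℕ))

/-- The monoid homomorphism extending the substitution `τ` to finite words. -/
def extend {A B : Type*} (τ : B → List A) (w : List B) : List A := w.flatMap τ

/-- The power `τ^t` of a substitution, `τ^0` being `a ↦ a`. -/
def power {A : Type*} (τ : A → List A) (t : ℕ) (a : A) : List A := (extend τ)^[t] [a]

/-- `y` is a desubstitution of `x` for `τ`: for some increasing sequence of cutting points `k`, the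
factor of `x` on `[k_s, k_{s+1})` is `τ (y_s)` for every `s`. -/
def IsDesubstitution {A B : Type*} (τ : B → List A) (x : ℤ → A) (y : ℤ → B) : Prop :=
  ∃ k : ℤ → ℤ, StrictMono k ∧ ∀ s : ℤ, word x (k s) (k (s + 1)) = τ (y s)

/-- The limit set `Ω_τ`: the configurations that can be desubstituted for every power of `τ`. -/
def limitSet {A : Type*} (τ : A → List A) : Set (ℤ → A) :=
  {x | ∀ t : ℕ, ∃ y : ℤ → A, IsDesubstitution (power τ t) x y}

/-- The substitutive shift of `τ`: the configurations all of whose finite factors appear in some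
`τ^t(a)`. -/
def languageShift {A : Type*} (τ : A → List A) : Set (ℤ → A) :=
  {x | ∀ i j : ℤ, ∃ (t : ℕ) (a : A), word x i j <:+: power τ t a}

/-- A Toeplitz substitution is left-proper, uniform, injective and expanding. -/
structure IsToeplitzSubstitution {A B : Type*} (τ : B → List A) : Prop where
  /-- all images start with the same letter -/
  left_proper : ∀ a b : B, (τ a).head? = (τ b).head?
  /-- all images have the same length -/
  uniform : ∀ a b : B, (τ a).length = (τ b).length
  injective : Function.Injective τ
  /-- all images have length at least two -/
  expanding : ∀ a : B, 2 ≤ (τ a).length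

/-- The substitution `k ↦ 0 1 ⋯ (n-1) k` over the alphabet `{0, …, n-1}`. -/
def prefixSubstitution (n : ℕ) (k : Fin n) : List (Fin n) := List.finRange n ++ [k]

end SubstShift

/-! Number the positions of `τ^t(a)` from `1` to `(n+1)^t`. If `d` is the last nonzero digit of `u`
in base `n+1`, position `u` carries the letter `d - 1`, except that the final position carries `a`.
So both the limit set and the substitutive shift equal `phaseSet n`: at each level `t` a
configuration is prescribed off one residue class modulo `(n+1)^t`, its phase.

Upper bound: a right half of a configuration determines all its phases (`HasPhase.dvd_sub`). Two
points that agree on a right half can thus differ only at an integer lying in every phase class.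
There is at most one such hole (`exists_hole`), and `n` letters can fill it. Lower bound:
`toeplitzPoint a` has phase `0` at every level, so its hole is the origin and `a` is arbitrary. Once
shifted past the window that the metric sees, these `n` points remain close forever. Minimality: a
short window has a single position left open at level `t`, and level `t+1` realises every letter
there (`HasPhase.exists_digit`). -/

namespace SubstShift

/-! ### Phases -/

/-- `x` has phase `c` at level `t`: every position `c + u` with `(n+1)^t ∤ u` carries the letter
determined by the last nonzero digit of `u` in base `n+1`. -/
def HasPhase (n t : ℕ) (c : ℤ) (x : ℤ → Fin n) : Prop :=
  ∀ v < t, ∀ (q : ℤ) (r : Fin n),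
    x (c + ((n : ℤ) + 1) ^ v * (((n : ℤ) + 1) * q + ((r : ℕ) + 1))) = r

/-- The configurations having a phase at every level. -/
def phaseSet (n : ℕ) : Set (ℤ → Fin n) := {x | ∀ t, ∃ c, HasPhase n t c x}

lemma base_pos (n : ℕ) : (0 : ℤ) < (n : ℤ) + 1 := by positivity

lemma dvd_or_eq_digit (n t : ℕ) (u : ℤ) : ((n : ℤ) + 1) ^ t ∣ u ∨
    ∃ v < t, ∃ (q : ℤ) (r : Fin n),
      u = ((n : ℤ) + 1) ^ v * (((n : ℤ) + 1) * q + ((r : ℕ) + 1)) := by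
  induction t with
  | zero => simp
  | succ t ih =>
    rcases ih with ⟨w, rfl⟩ | ⟨v, hv, q, r, h⟩
    · have h1 := Int.mul_ediv_add_emod w ((n : ℤ) + 1)
      have h2 := Int.emod_nonneg w (base_pos n).ne'
      have h3 := Int.emod_lt_of_pos w (base_pos n)
      by_cases h0 : w % ((n : ℤ) + 1) = 0
      · left
        rw [pow_succ]
        exact mul_dvd_mul_left _ (Int.dvd_of_emod_eq_zero h0)
      · right
        refine ⟨t, by omega, w / ((n : ℤ) + 1), ⟨(w % ((n : ℤ) + 1) - 1).toNat, by omega⟩, ?_⟩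
        congr 1
        have : (((w % ((n : ℤ) + 1) - 1).toNat : ℕ) : ℤ) = w % ((n : ℤ) + 1) - 1 := by omega
        simp only [this]
        linarith
    · exact Or.inr ⟨v, by omega, q, r, h⟩

lemma not_base_dvd_digit {n : ℕ} (q : ℤ) (r : Fin n) :
    ¬ ((n : ℤ) + 1) ∣ ((n : ℤ) + 1) * q + ((r : ℕ) + 1) := by
  intro h
  have h1 : ((n : ℤ) + 1) ∣ ((r : ℕ) + 1 : ℤ) := (Int.dvd_add_right (Dvd.intro _ rfl)).1 h
  have h2 := Int.le_of_dvd (by positivity) h1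
  have := r.2
  omega

lemma not_dvd_digit {n v t : ℕ} (hv : v < t) (q : ℤ) (r : Fin n) :
    ¬ ((n : ℤ) + 1) ^ t ∣ ((n : ℤ) + 1) ^ v * (((n : ℤ) + 1) * q + ((r : ℕ) + 1)) := by
  intro h
  have h1 : ((n : ℤ) + 1) ^ v * ((n : ℤ) + 1) ∣
      ((n : ℤ) + 1) ^ v * (((n : ℤ) + 1) * q + ((r : ℕ) + 1)) := by
    rw [← pow_succ]
    exact (pow_dvd_pow _ hv).trans h
  exact not_base_dvd_digit q r
    (Int.dvd_of_mul_dvd_mul_left (pow_pos (base_pos n) v).ne' h1)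

lemma digit_unique {n v v' : ℕ} {q q' : ℤ} {r r' : Fin n}
    (h : ((n : ℤ) + 1) ^ v * (((n : ℤ) + 1) * q + ((r : ℕ) + 1)) =
      ((n : ℤ) + 1) ^ v' * (((n : ℤ) + 1) * q' + ((r' : ℕ) + 1))) : r = r' := by
  rcases lt_trichotomy v v' with hv | rfl | hv
  · exact absurd (h ▸ Dvd.intro _ rfl) (not_dvd_digit hv q r)
  · have h1 := mul_left_cancel₀ (pow_pos (base_pos n) v).ne' h
    have h2 : ((n : ℤ) + 1) ∣ (r' : ℕ) - (r : ℕ) := ⟨q - q', by linarith⟩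
    have := r.2
    have := r'.2
    have h3 := Int.eq_zero_of_abs_lt_dvd h2 (by rw [abs_lt]; omega)
    ext
    omega
  · exact absurd (h ▸ Dvd.intro _ rfl) (not_dvd_digit hv q' r')

lemma exists_digit_add {n v t : ℕ} (hv : v < t) (q d : ℤ) (r : Fin n) :
    ∃ q', ((n : ℤ) + 1) ^ v * (((n : ℤ) + 1) * q + ((r : ℕ) + 1)) + ((n : ℤ) + 1) ^ t * d =
      ((n : ℤ) + 1) ^ v * (((n : ℤ) + 1) * q' + ((r : ℕ) + 1)) := by
  obtain ⟨k, rfl⟩ := Nat.exists_eq_add_of_lt hv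
  exact ⟨q + ((n : ℤ) + 1) ^ k * d, by ring⟩

lemma HasPhase.mono {n t t' : ℕ} {c : ℤ} {x : ℤ → Fin n} (h : HasPhase n t c x) (ht : t' ≤ t) :
    HasPhase n t' c x := fun v hv => h v (hv.trans_le ht)

lemma HasPhase.add_mul {n t : ℕ} {c : ℤ} {x : ℤ → Fin n} (h : HasPhase n t c x) (d : ℤ) :
    HasPhase n t (c + ((n : ℤ) + 1) ^ t * d) x := by
  intro v hv q r
  obtain ⟨q', hq'⟩ := exists_digit_add hv q d r
  rw [add_assoc, add_comm (((n : ℤ) + 1) ^ t * d), hq']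
  exact h v hv q' r

lemma HasPhase.congr {n t : ℕ} {c c' : ℤ} {x : ℤ → Fin n} (h : HasPhase n t c x)
    (hc : ((n : ℤ) + 1) ^ t ∣ c' - c) : HasPhase n t c' x := by
  obtain ⟨d, hd⟩ := hc
  have := h.add_mul d
  rwa [← hd, add_sub_cancel] at this

lemma HasPhase.base_dvd_sub {n : ℕ} (hn : 2 ≤ n) {c c' N : ℤ} {x y : ℤ → Fin n}
    (hx : HasPhase n 1 c x) (hy : HasPhase n 1 c' y) (hxy : ∀ i ≥ N, x i = y i) :
    ((n : ℤ) + 1) ∣ c' - c := by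
  have h1 := Int.mul_ediv_add_emod (c' - c) ((n : ℤ) + 1)
  have h2 := Int.emod_nonneg (c' - c) (base_pos n).ne'
  have h3 := Int.emod_lt_of_pos (c' - c) (base_pos n)
  apply Int.dvd_of_emod_eq_zero
  by_contra h0
  set δ := (c' - c) % ((n : ℤ) + 1)
  set Q := (c' - c) / ((n : ℤ) + 1)
  obtain ⟨q, hq⟩ : ∃ q : ℤ, N ≤ c' + (((n : ℤ) + 1) * q) := by
    refine ⟨|N - c'|, ?_⟩
    have := le_abs_self (N - c')
    nlinarith [abs_nonneg (N - c')]
  -- Position `c' + (n+1)q + 1` carries `0` in `y`, but has digit `δ + 1` relative to `c`, hence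
  -- carries `δ ≠ 0` in `x`.
  by_cases hδ : δ < n
  · have e1 := hy 0 one_pos q ⟨0, by omega⟩
    have e2 := hx 0 one_pos (Q + q) ⟨δ.toNat, by omega⟩
    have e3 : c + ((n : ℤ) + 1) ^ 0 * (((n : ℤ) + 1) * (Q + q) + ((δ.toNat : ℕ) + 1)) =
        c' + ((n : ℤ) + 1) ^ 0 * (((n : ℤ) + 1) * q + ((0 : ℕ) + 1)) := by
      rw [Int.toNat_of_nonneg h2]
      push_cast
      linear_combination h1
    simp only [] at e1 e2
    rw [e3, hxy _ (by simp; linarith), e1] at e2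
    have := congrArg Fin.val e2
    simp at this
    omega
  -- For `δ = n` that position is open in `x`. The next one carries `1` in `y` and `0` in `x`; this
  -- needs two letters.
  · have e1 := hy 0 one_pos q ⟨1, by omega⟩
    have e2 := hx 0 one_pos (Q + q + 1) ⟨0, by omega⟩
    have hδ' : δ = n := by omega
    have e3 : c + ((n : ℤ) + 1) ^ 0 * (((n : ℤ) + 1) * (Q + q + 1) + ((0 : ℕ) + 1)) =
        c' + ((n : ℤ) + 1) ^ 0 * (((n : ℤ) + 1) * q + ((1 : ℕ) + 1)) := by
      push_cast
      linear_combination h1 - hδ'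
    simp only [] at e1 e2
    rw [e3, hxy _ (by simp; linarith), e1] at e2
    have := congrArg Fin.val e2
    simp at this

/-- Desubstitution: the letters along the level-`t` class, read as a configuration, have a phase of
level `1`, so `HasPhase.base_dvd_sub` yields one more digit of `c' - c`. -/
lemma HasPhase.dvd_sub {n : ℕ} (hn : 2 ≤ n) {t : ℕ} {c c' N : ℤ} {x y : ℤ → Fin n}
    (hx : HasPhase n t c x) (hy : HasPhase n t c' y) (hxy : ∀ i ≥ N, x i = y i) :
    ((n : ℤ) + 1) ^ t ∣ c' - c := by
  induction t with
  | zero => simp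
  | succ t ih =>
    obtain ⟨d, hd⟩ := ih (hx.mono t.le_succ) (hy.mono t.le_succ)
    have key : ∀ {a : ℤ} {z : ℤ → Fin n} (b : ℤ), HasPhase n (t + 1) a z →
        a = c + ((n : ℤ) + 1) ^ t * b →
        HasPhase n 1 b (fun s => z (c + ((n : ℤ) + 1) ^ t * s)) := by
      intro a z b hz hab v hv q r
      obtain rfl : v = 0 := by omega
      have := hz t t.lt_succ_self q r
      rw [hab] at this
      convert this using 2
      ring
    have h := HasPhase.base_dvd_sub hn (N := |N - c|) (key 0 hx (by simp)) (key d hy (by linarith))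
      (fun i hi => hxy _ ?_)
    · rw [hd, pow_succ]
      exact mul_dvd_mul_left _ (by simpa using h)
    · have h1 := le_abs_self (N - c)
      have h2 : (1 : ℤ) ≤ ((n : ℤ) + 1) ^ t := pow_pos (base_pos n) t
      nlinarith [abs_nonneg (N - c)]

/-- Two points of `phaseSet` that eventually agree on the right differ in at most one position,
which depends only on the first point. -/
lemma exists_hole {n : ℕ} (hn : 2 ≤ n) {x : ℤ → Fin n} (hx : x ∈ phaseSet n) :
    ∃ h : ℤ, ∀ y ∈ phaseSet n, ∀ N : ℤ, (∀ i ≥ N, x i = y i) → ∀ i, i ≠ h → x i = y i := by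
  choose c hc using hx
  have key : ∀ y ∈ phaseSet n, ∀ N : ℤ, (∀ i ≥ N, x i = y i) → ∀ i, x i ≠ y i →
      ∀ t, ((n : ℤ) + 1) ^ t ∣ i - c t := by
    intro y hy N hxy i hi t
    obtain ⟨c', hc'⟩ := hy t
    rcases dvd_or_eq_digit n t (i - c t) with h | ⟨v, hv, q, r, h⟩
    · exact h
    · refine absurd ?_ hi
      have hy' : HasPhase n t (c t) y := by
        refine hc'.congr ?_
        rw [dvd_sub_comm]
        exact (hc t).dvd_sub hn hc' hxy
      have e : i = c t + (i - c t) := by ring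
      rw [e, h, hc t v hv, hy' v hv]
  by_cases hh : ∃ h, ∀ t, ((n : ℤ) + 1) ^ t ∣ h - c t
  · obtain ⟨h, hh⟩ := hh
    refine ⟨h, fun y hy N hxy i hi => by_contra fun hne => hi ?_⟩
    -- The level `m = |i - h|` suffices, since `m < (n+1)^m`.
    have h1 := key y hy N hxy i hne (i - h).natAbs
    have h2 := dvd_sub h1 (hh (i - h).natAbs)
    rw [sub_sub_sub_cancel_right] at h2
    have h3 : |i - h| < ((n : ℤ) + 1) ^ (i - h).natAbs := by
      rw [Int.abs_eq_natAbs]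
      exact_mod_cast Nat.lt_pow_self (by omega : 1 < n + 1)
    exact sub_eq_zero.1 (Int.eq_zero_of_abs_lt_dvd h2 h3)
  -- Without a hole no position can differ, and `0` is a dummy value.
  · exact ⟨0, fun y hy N hxy i _ => by_contra fun hne => hh ⟨i, key y hy N hxy i hne⟩⟩

/-! ### Toeplitz points with a hole at the origin -/

open Classical in
/-- The configuration with phase `0` at every level and letter `a` at the origin. -/
noncomputable def toeplitzPoint {n : ℕ} (a : Fin n) (u : ℤ) : Fin n :=
  if h : ∃ (r : Fin n) (v : ℕ) (q : ℤ),
    u = ((n : ℤ) + 1) ^ v * (((n : ℤ) + 1) * q + ((r : ℕ) + 1)) then h.choose else a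

lemma hasPhase_toeplitzPoint {n : ℕ} (a : Fin n) (t : ℕ) : HasPhase n t 0 (toeplitzPoint a) := by
  intro v _ q r
  have h : ∃ (r' : Fin n) (v' : ℕ) (q' : ℤ),
      0 + ((n : ℤ) + 1) ^ v * (((n : ℤ) + 1) * q + ((r : ℕ) + 1)) =
        ((n : ℤ) + 1) ^ v' * (((n : ℤ) + 1) * q' + ((r' : ℕ) + 1)) := ⟨r, v, q, zero_add _⟩
  rw [toeplitzPoint, dif_pos h]
  obtain ⟨v', q', h'⟩ := h.choose_spec
  exact (digit_unique ((zero_add _).symm.trans h')).symm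

lemma toeplitzPoint_mem {n : ℕ} (a : Fin n) : toeplitzPoint a ∈ phaseSet n :=
  fun t => ⟨0, hasPhase_toeplitzPoint a t⟩

lemma toeplitzPoint_zero {n : ℕ} (a : Fin n) : toeplitzPoint a 0 = a := by
  refine dif_neg ?_
  rintro ⟨r, v, q, h⟩
  exact not_dvd_digit v.lt_succ_self q r (h ▸ dvd_zero _)

lemma toeplitzPoint_eq {n : ℕ} (hn : 0 < n) (a b : Fin n) {u : ℤ} (hu : u ≠ 0) :
    toeplitzPoint a u = toeplitzPoint b u := by
  rcases dvd_or_eq_digit n u.natAbs u with h | ⟨v, hv, q, r, h⟩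
  · refine absurd (Int.eq_zero_of_abs_lt_dvd h ?_) hu
    rw [Int.abs_eq_natAbs]
    exact_mod_cast Nat.lt_pow_self (by omega : 1 < n + 1)
  · have ha := hasPhase_toeplitzPoint a _ v hv q r
    have hb := hasPhase_toeplitzPoint b _ v hv q r
    rw [zero_add, ← h] at ha hb
    rw [ha, hb]

/-! ### Topology -/

lemma HasPhase.shift {n t : ℕ} {c : ℤ} {x : ℤ → Fin n} (h : HasPhase n t c x) (k : ℤ) :
    HasPhase n t (c - k) (SymbolicDynamics.FullShift.shift k x) := by
  intro v hv q r
  rw [SymbolicDynamics.FullShift.shift_apply, ← add_assoc, add_sub_cancel]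
  exact h v hv q r

lemma isClosed_hasPhase (n t : ℕ) (c : ℤ) : IsClosed {x | HasPhase n t c x} := by
  simp only [HasPhase, Set.ofPred_forall]
  refine isClosed_iInter fun v => isClosed_iInter fun _ => isClosed_iInter fun q =>
    isClosed_iInter fun r => ?_
  exact isClosed_eq (continuous_apply _) continuous_const

lemma HasPhase.exists_mem_Ico {n t : ℕ} {c : ℤ} {x : ℤ → Fin n} (h : HasPhase n t c x) :
    ∃ d ∈ Finset.Ico (0 : ℤ) (((n : ℤ) + 1) ^ t), HasPhase n t d x := by
  have hp := pow_pos (base_pos n) t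
  refine ⟨c % ((n : ℤ) + 1) ^ t, ?_, h.congr ?_⟩
  · rw [Finset.mem_Ico]
    exact ⟨Int.emod_nonneg _ hp.ne', Int.emod_lt_of_pos _ hp⟩
  · rw [dvd_sub_comm]
    exact Int.dvd_self_sub_emod

/-- A phase matters only modulo `(n+1)^t`, so each level is a finite union of closed sets. -/
lemma isClosed_phaseSet (n : ℕ) : IsClosed (phaseSet n) := by
  have : phaseSet n = ⋂ t, ⋃ c ∈ Finset.Ico (0 : ℤ) (((n : ℤ) + 1) ^ t),
      {x | HasPhase n t c x} := by
    ext x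
    simp only [phaseSet, Set.mem_ofPred_eq, Set.mem_iInter, Set.mem_iUnion, exists_prop]
    exact forall_congr' fun t => ⟨fun ⟨c, h⟩ => h.exists_mem_Ico, fun ⟨c, _, h⟩ => ⟨c, h⟩⟩
  rw [this]
  exact isClosed_iInter fun t => isClosed_biUnion_finset fun c _ => isClosed_hasPhase n t c

/-- The subshift of configurations having a phase at every level. -/
def phaseShift (n : ℕ) : SymbolicDynamics.FullShift.Subshift (Fin n) ℤ where
  carrier := phaseSet n
  isClosed := isClosed_phaseSet n
  mapsTo := fun k _ hx t => (hx t).elim fun c hc => ⟨c - k, hc.shift k⟩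

lemma shiftMap_iterate_apply {A : Type*} [TopologicalSpace A]
    (X : SymbolicDynamics.FullShift.Subshift A ℤ) (x : X.carrier) (k : ℕ) (i : ℤ) :
    ((shiftMap X)^[k] x : ℤ → A) i = (x : ℤ → A) (k + i) := by
  induction k generalizing x with
  | zero => simp
  | succ k ih =>
    rw [Function.iterate_succ_apply, ih]
    have : ((k + 1 : ℕ) : ℤ) + i = 1 + (k + i) := by
      push_cast
      ring
    rw [this]
    rfl

/-! ### Recurrence of windows -/

/-- A phase of level `t` can be chosen inside any window of length `(n+1)^t`. -/
lemma HasPhase.exists_mem_window {n t : ℕ} {c : ℤ} {y : ℤ → Fin n} (h : HasPhase n t c y) (i : ℤ) :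
    ∃ c', i ≤ c' ∧ c' < i + ((n : ℤ) + 1) ^ t ∧ HasPhase n t c' y := by
  have hp := pow_pos (base_pos n) t
  have h1 := Int.emod_nonneg (c - i) hp.ne'
  have h2 := Int.emod_lt_of_pos (c - i) hp
  refine ⟨i + (c - i) % ((n : ℤ) + 1) ^ t, by omega, by omega, h.congr ?_⟩
  rw [dvd_sub_comm, ← sub_sub]
  exact Int.dvd_self_sub_emod

/-- Only `c` is left open in the window at level `t`. Moving it to an offset whose level-`t` digit
is `y c + 1` gives each `l` an offset with last nonzero digit `y l + 1`, so a phase of level `t + 1`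
forces a copy of the window. -/
lemma HasPhase.exists_digit {n t : ℕ} {c i l : ℤ} {y : ℤ → Fin n} (h : HasPhase n t c y)
    (hc : i ≤ c) (hc' : c < i + ((n : ℤ) + 1) ^ t) (hl : i ≤ l) (hl' : l < i + ((n : ℤ) + 1) ^ t)
    (q : ℤ) :
    ∃ v < t + 1, ∃ q', ((n : ℤ) + 1) ^ t * (((n : ℤ) + 1) * q + ((y c : ℕ) + 1)) + (l - c) =
      ((n : ℤ) + 1) ^ v * (((n : ℤ) + 1) * q' + ((y l : ℕ) + 1)) := by
  rcases dvd_or_eq_digit n t (l - c) with hd | ⟨v, hv, q', r, hd⟩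
  · have := Int.eq_zero_of_abs_lt_dvd hd (by rw [abs_lt]; omega)
    obtain rfl : l = c := by omega
    exact ⟨t, t.lt_succ_self, q, by simp⟩
  · have hr : y l = r := by
      have := h v hv q' r
      rwa [← hd, add_sub_cancel] at this
    obtain ⟨q'', hq''⟩ := exists_digit_add hv q' (((n : ℤ) + 1) * q + ((y c : ℕ) + 1)) r
    refine ⟨v, by omega, q'', ?_⟩
    rw [hr, ← hq'', hd, add_comm]

lemma exists_iterate_agree {n : ℕ} (hn : 0 < n) {x y : ℤ → Fin n} (hx : x ∈ phaseSet n)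
    (hy : y ∈ phaseSet n) (N : ℕ) :
    ∃ k : ℕ, ∀ l : ℤ, |l| ≤ N → x (k + l) = y l := by
  obtain ⟨c₀, hc₀⟩ := hy (2 * N + 1)
  obtain ⟨c, h1, h2, hc⟩ := hc₀.exists_mem_window (-N)
  obtain ⟨c', hc'⟩ := hx (2 * N + 1 + 1)
  have hN : (2 * N + 1 : ℤ) < ((n : ℤ) + 1) ^ (2 * N + 1) := by
    exact_mod_cast Nat.lt_pow_self (by omega : 1 < n + 1)
  set M := ((n : ℤ) + 1) ^ (2 * N + 1)
  -- The multiple `|c - c'|` only serves to make `k` nonnegative.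
  obtain ⟨k, hk⟩ : ∃ k : ℕ,
      (k : ℤ) = c' + M * (((n : ℤ) + 1) * |c - c'| + ((y c : ℕ) + 1)) - c := by
    refine ⟨_, Int.toNat_of_nonneg ?_⟩
    have h3 := le_abs_self (c - c')
    have h4 : |c - c'| ≤ ((n : ℤ) + 1) * |c - c'| + ((y c : ℕ) + 1) := by
      nlinarith [abs_nonneg (c - c')]
    have h5 := abs_nonneg (c - c')
    nlinarith
  refine ⟨k, fun l hl => ?_⟩
  rw [abs_le] at hl
  obtain ⟨v, hv, q', e⟩ := hc.exists_digit h1 h2 hl.1 (show l < -N + M by omega) |c - c'|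
  have : (k : ℤ) + l = c' + ((n : ℤ) + 1) ^ v * (((n : ℤ) + 1) * q' + ((y l : ℕ) + 1)) := by
    rw [← e, hk]
    ring
  rw [this, hc' v hv]

lemma isMinimalSystem_phaseShift {n : ℕ} (hn : 0 < n) :
    IsMinimalSystem (shiftMap (phaseShift n)) := by
  refine ⟨⟨⟨_, toeplitzPoint_mem ⟨0, hn⟩⟩⟩, fun x => ?_⟩
  choose k hk using fun (y : (phaseShift n).carrier) => exists_iterate_agree hn x.2 y.2
  intro y
  refine mem_closure_of_tendsto (f := fun N => (shiftMap (phaseShift n))^[k y N] x)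
    (b := Filter.atTop) ?_ (Filter.Eventually.of_forall fun N => ⟨_, rfl⟩)
  rw [tendsto_subtype_rng, tendsto_pi_nhds]
  intro i
  refine tendsto_const_nhds.congr' ?_
  filter_upwards [Filter.eventually_ge_atTop i.natAbs] with N hN
  rw [shiftMap_iterate_apply, hk y N i (by rw [Int.abs_eq_natAbs]; exact_mod_cast hN)]

/-! ### Expansiveness -/

/-- A locally constant map on a compact space is uniformly so; hence the choice of metric is
irrelevant. -/
lemma exists_dist_lt_imp_eq {X A : Type*} [MetricSpace X] [CompactSpace X] [TopologicalSpace A]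
    [DiscreteTopology A] {φ : X → A} (hφ : Continuous φ) :
    ∃ ε > 0, ∀ x y, dist x y < ε → φ x = φ y := by
  have hU : IsOpen {p : X × X | φ p.1 = φ p.2} :=
    (isOpen_discrete {p : A × A | p.1 = p.2}).preimage
      ((hφ.comp continuous_fst).prodMk (hφ.comp continuous_snd))
  have h : {p : X × X | φ p.1 = φ p.2} ∈ uniformity X := by
    rw [← nhdsSet_diagonal_eq_uniformity, hU.mem_nhdsSet]
    rintro ⟨x, y⟩ hxy
    exact congrArg φ hxy
  obtain ⟨ε, hε, h⟩ := Metric.mem_uniformity_dist.1 h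
  exact ⟨ε, hε, fun x y hxy => h hxy⟩

/-- The closed sets of pairs agreeing on `[-N, N]` decrease to the diagonal, so by compactness one
of them lies in the open set `dist < ε`. -/
lemma exists_agree_imp_dist_lt {X A : Type*} [MetricSpace X] [CompactSpace X] [TopologicalSpace A]
    [T2Space A] {φ : X → ℤ → A} (hφ : Continuous φ) (hinj : Function.Injective φ)
    {ε : ℝ} (hε : 0 < ε) :
    ∃ N : ℕ, ∀ x y, (∀ i : ℤ, |i| ≤ N → φ x i = φ y i) → dist x y < ε := by
  have hc : ∀ i, Continuous fun x => φ x i := fun i => (continuous_apply i).comp hφ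
  obtain ⟨N, hN⟩ := exists_subset_nhds_of_compactSpace
    (V := fun N : ℕ => {p : X × X | ∀ i : ℤ, |i| ≤ N → φ p.1 i = φ p.2 i})
    (U := {p : X × X | dist p.1 p.2 < ε})
    (directed_of_isDirected_le fun M N hMN p hp i hi => hp i (hi.trans (by exact_mod_cast hMN)))
    (fun N => by
      simp only [Set.ofPred_forall]
      exact isClosed_iInter fun i => isClosed_iInter fun _ =>
        isClosed_eq ((hc i).comp continuous_fst) ((hc i).comp continuous_snd))
    (fun p hp => by
      refine (isOpen_lt continuous_dist continuous_const).mem_nhds ?_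
      have : p.1 = p.2 := by
        refine hinj (funext fun i => ?_)
        exact Set.mem_iInter.1 hp i.natAbs i (Int.abs_eq_natAbs i).le
      simpa [this] using hε)
  exact ⟨N, fun x y h => hN (a := (x, y)) h⟩

lemma isPositivelyExpansive_phaseShift {n : ℕ} (hn : 2 ≤ n) (d : MetricSpace (phaseShift n).carrier)
    (hd : d.toPseudoMetricSpace.toUniformSpace.toTopologicalSpace = instTopologicalSpaceSubtype) :
    IsPositivelyExpansive n (shiftMap (phaseShift n)) := by
  have hK : @CompactSpace _ d.toPseudoMetricSpace.toUniformSpace.toTopologicalSpace := by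
    rw [hd]
    exact isCompact_iff_compactSpace.1 (phaseShift n).isClosed.isCompact
  have hφ : @Continuous _ _ d.toPseudoMetricSpace.toUniformSpace.toTopologicalSpace _
      fun x : (phaseShift n).carrier => (x : ℤ → Fin n) 0 := by
    rw [hd]
    exact (continuous_apply 0).comp continuous_subtype_val
  obtain ⟨ε, hε, h⟩ := @exists_dist_lt_imp_eq _ _ d hK _ _ _ hφ
  refine ⟨ε, hε, fun x => ?_⟩
  obtain ⟨p, hp⟩ := exists_hole hn x.2
  have hagree : ∀ y ∈ dynBall (shiftMap (phaseShift n)) ε x, ∀ i, i ≠ p → x.1 i = y.1 i := by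
    intro y hy
    refine hp y y.2 0 fun i hi => ?_
    lift i to ℕ using hi
    have := h _ _ (hy i)
    simpa only [shiftMap_iterate_apply, add_zero] using this
  have hinj : Set.InjOn (fun y : (phaseShift n).carrier => y.1 p)
      (dynBall (shiftMap (phaseShift n)) ε x) := by
    intro y hy z hz hyz
    ext i : 2
    by_cases hi : i = p
    · rw [hi]
      exact hyz
    · rw [← hagree y hy i hi, hagree z hz i hi]
  rw [← hinj.encard_image]
  refine (Set.encard_le_encard (Set.subset_univ _)).trans ?_
  simp

lemma not_isPositivelyExpansive_phaseShift {n : ℕ} (hn : 0 < n)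
    (d : MetricSpace (phaseShift n).carrier)
    (hd : d.toPseudoMetricSpace.toUniformSpace.toTopologicalSpace = instTopologicalSpaceSubtype) :
    ¬ IsPositivelyExpansive (n - 1) (shiftMap (phaseShift n)) := by
  have hK : @CompactSpace _ d.toPseudoMetricSpace.toUniformSpace.toTopologicalSpace := by
    rw [hd]
    exact isCompact_iff_compactSpace.1 (phaseShift n).isClosed.isCompact
  have hφ : @Continuous _ _ d.toPseudoMetricSpace.toUniformSpace.toTopologicalSpace _
      fun x : (phaseShift n).carrier => (x : ℤ → Fin n) := by
    rw [hd]
    exact continuous_subtype_val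
  rintro ⟨ε, hε, h⟩
  obtain ⟨N, hN⟩ :=
    @exists_agree_imp_dist_lt _ _ d hK _ _ _ hφ Subtype.val_injective _ hε
  set f := shiftMap (phaseShift n)
  -- The hole now sits at `-(N+1)`, just left of the window `[-N, N]`, and further shifts push it
  -- away.
  let T : Fin n → (phaseShift n).carrier := fun a => f^[N + 1] ⟨_, toeplitzPoint_mem a⟩
  have hT : ∀ a i, (T a).1 i = toeplitzPoint a ((N + 1 : ℕ) + i) := fun a i =>
    shiftMap_iterate_apply _ _ _ _
  have hTinj : Function.Injective T := by
    intro a b hab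
    have := congrArg (fun z : (phaseShift n).carrier => z.1 (-(N + 1 : ℕ))) hab
    simpa only [hT, add_neg_cancel, toeplitzPoint_zero] using this
  have hsub : Set.range T ⊆ dynBall f ε (T ⟨0, hn⟩) := by
    rintro _ ⟨a, rfl⟩ t
    refine hN _ _ fun i hi => ?_
    rw [abs_le] at hi
    refine ((shiftMap_iterate_apply _ (T ⟨0, hn⟩) t i).trans (hT _ _)).trans (Eq.trans ?_
      ((shiftMap_iterate_apply _ (T a) t i).trans (hT _ _)).symm)
    exact toeplitzPoint_eq hn _ _ (by push_cast; omega)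
  have h1 := (Set.encard_le_encard hsub).trans (h _)
  rw [← Set.image_univ, hTinj.encard_image, Set.encard_univ, ENat.card_eq_coe_fintype_card,
    Fintype.card_fin] at h1
  have : n ≤ n - 1 := by exact_mod_cast h1
  omega


/-! ### Powers of the substitution -/

lemma prefixSubstitution_length (n : ℕ) (a : Fin n) :
    (prefixSubstitution n a).length = n + 1 := by
  simp [prefixSubstitution]

lemma prefixSubstitution_getElem? {n : ℕ} (a r : Fin n) :
    (prefixSubstitution n a)[(r : ℕ)]? = some r := by
  rw [prefixSubstitution, List.getElem?_append_left (by simp)]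
  simp

lemma prefixSubstitution_getElem?_last {n : ℕ} (a : Fin n) :
    (prefixSubstitution n a)[n]? = some a := by
  simp [prefixSubstitution]

lemma isToeplitzSubstitution_prefixSubstitution {n : ℕ} (hn : 0 < n) :
    IsToeplitzSubstitution (prefixSubstitution n) where
  left_proper a b := by
    have h := fun c : Fin n => prefixSubstitution_getElem? c ⟨0, hn⟩
    rw [List.head?_eq_getElem?, List.head?_eq_getElem?]
    exact (h a).trans (h b).symm
  uniform a b := by simp only [prefixSubstitution_length]
  injective a b h := by
    have ha := prefixSubstitution_getElem?_last a
    rw [h, prefixSubstitution_getElem?_last] at ha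
    exact (Option.some.inj ha).symm
  expanding a := by
    rw [prefixSubstitution_length]
    omega

lemma extend_length {n : ℕ} (w : List (Fin n)) :
    (extend (prefixSubstitution n) w).length = (n + 1) * w.length := by
  simp [extend, List.length_flatMap, prefixSubstitution_length, mul_comm]

lemma extend_getElem? {n : ℕ} (w : List (Fin n)) (p j : ℕ) (hj : j < n + 1) :
    (extend (prefixSubstitution n) w)[(n + 1) * p + j]? =
      w[p]?.bind fun a => (prefixSubstitution n a)[j]? := by
  induction w generalizing p with
  | nil => simp [extend]
  | cons a w ih =>
    have hc : extend (prefixSubstitution n) (a :: w) =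
      prefixSubstitution n a ++ extend (prefixSubstitution n) w := by simp [extend]
    rw [hc]
    cases p with
    | zero =>
      rw [List.getElem?_append_left (by rw [prefixSubstitution_length]; omega)]
      simp
    | succ p =>
      have e : (n + 1) * (p + 1) + j = (prefixSubstitution n a).length + ((n + 1) * p + j) := by
        rw [prefixSubstitution_length]
        ring
      rw [e, List.getElem?_append_right (by omega), Nat.add_sub_cancel_left, ih,
        List.getElem?_cons_succ]

lemma power_succ {A : Type*} (τ : A → List A) (t : ℕ) (a : A) :
    power τ (t + 1) a = extend τ (power τ t a) :=
  Function.iterate_succ_apply' _ _ _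

lemma power_length (n t : ℕ) (a : Fin n) :
    (power (prefixSubstitution n) t a).length = (n + 1) ^ t := by
  induction t with
  | zero => simp [power]
  | succ t ih => rw [power_succ, extend_length, ih, pow_succ']

lemma power_getElem?_last {n t p : ℕ} (a : Fin n) (hp : p + 1 = (n + 1) ^ t) :
    (power (prefixSubstitution n) t a)[p]? = some a := by
  induction t generalizing p with
  | zero =>
    obtain rfl : p = 0 := by simpa using hp
    simp [power]
  | succ t ih =>
    obtain ⟨p', hp'⟩ := Nat.exists_eq_succ_of_ne_zero (pow_pos (Nat.succ_pos n) t).ne'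
    have e : p = (n + 1) * p' + n := by
      have : p + 1 = (n + 1) * p' + n + 1 := by
        rw [hp, pow_succ', hp', Nat.succ_eq_add_one]
        ring
      omega
    rw [power_succ, e, extend_getElem? _ _ _ n.lt_succ_self, ih hp'.symm]
    exact prefixSubstitution_getElem?_last a

/-- Block `p'` of the next power ends with letter `p'` of the previous one: dividing `p + 1` by
`n+1` lowers both `t` and `v`. -/
lemma power_getElem?_nat {n t v q p : ℕ} (a r : Fin n) (hv : v < t) (hpt : p < (n + 1) ^ t)
    (hp : p + 1 = (n + 1) ^ v * ((n + 1) * q + (r + 1))) :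
    (power (prefixSubstitution n) t a)[p]? = some r := by
  induction t generalizing p v with
  | zero => omega
  | succ t ih =>
    rw [power_succ]
    cases v with
    | zero =>
      have e : p = (n + 1) * q + r := by
        rw [pow_zero, one_mul] at hp
        omega
      have hq : q < (power (prefixSubstitution n) t a).length := by
        rw [power_length]
        rw [e, pow_succ'] at hpt
        exact Nat.lt_of_mul_lt_mul_left ((Nat.le_add_right _ _).trans_lt hpt)
      rw [e, extend_getElem? _ _ _ (by omega), List.getElem?_eq_getElem hq]
      exact prefixSubstitution_getElem? _ _
    | succ v =>
      obtain ⟨p', hp'⟩ : ∃ p', p' + 1 = (n + 1) ^ v * ((n + 1) * q + (r + 1)) := by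
        obtain ⟨p', h⟩ := Nat.exists_eq_succ_of_ne_zero
          (by positivity : (n + 1) ^ v * ((n + 1) * q + ((r : ℕ) + 1)) ≠ 0)
        exact ⟨p', h.symm⟩
      have e : p = (n + 1) * p' + n := by
        have : p + 1 = (n + 1) * p' + n + 1 := by
          rw [hp, pow_succ', mul_assoc, ← hp']
          ring
        omega
      have hp't : p' < (n + 1) ^ t := by
        rw [e, pow_succ'] at hpt
        exact Nat.lt_of_mul_lt_mul_left ((Nat.le_add_right _ _).trans_lt hpt)
      rw [e, extend_getElem? _ _ _ n.lt_succ_self, ih (by omega) hp't hp']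
      exact prefixSubstitution_getElem?_last r

lemma power_getElem? {n t v p : ℕ} {q : ℤ} (a r : Fin n) (hv : v < t) (hpt : p < (n + 1) ^ t)
    (hp : (p : ℤ) + 1 = ((n : ℤ) + 1) ^ v * (((n : ℤ) + 1) * q + ((r : ℕ) + 1))) :
    (power (prefixSubstitution n) t a)[p]? = some r := by
  have hq : 0 ≤ q := by
    by_contra! hq
    have h1 := pow_pos (base_pos n) v
    have h2 : ((n : ℤ) + 1) * q + ((r : ℕ) + 1) ≤ 0 := by
      have := r.2
      nlinarith
    nlinarith
  lift q to ℕ using hq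
  exact power_getElem?_nat a r hv hpt (by exact_mod_cast hp)

/-! ### Factors -/

lemma word_length {A : Type*} (x : ℤ → A) (i j : ℤ) : (word x i j).length = (j - i).toNat := by
  simp [word]

lemma word_getElem? {A : Type*} (x : ℤ → A) {i j : ℤ} {l : ℕ} (hl : (l : ℤ) < j - i) :
    (word x i j)[l]? = some (x (i + l)) := by
  have : l < (j - i).toNat := by omega
  simp [word, this]

lemma isInfix_of_getElem? {A : Type*} {w u : List A} {L : ℕ}
    (h : ∀ l < w.length, u[L + l]? = w[l]?) : w <:+: u := by
  have : w = (u.drop L).take w.length := by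
    refine List.ext_getElem? fun l => ?_
    rw [List.getElem?_take, List.getElem?_drop]
    split_ifs with hl
    · exact (h l hl).symm
    · exact List.getElem?_eq_none (not_lt.1 hl)
  rw [this]
  exact (List.take_prefix _ _).isInfix.trans (List.drop_suffix _ _).isInfix

lemma exists_getElem?_of_isInfix {A : Type*} {w u : List A} (h : w <:+: u) :
    ∃ L, ∀ l < w.length, u[L + l]? = w[l]? := by
  obtain ⟨s, s', rfl⟩ := h
  refine ⟨s.length, fun l hl => ?_⟩
  rw [List.append_assoc, List.getElem?_append_right (by omega), Nat.add_sub_cancel_left,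
    List.getElem?_append_left hl]

/-! ### The limit set -/

lemma limitSet_subset_phaseSet (n : ℕ) : limitSet (prefixSubstitution n) ⊆ phaseSet n := by
  intro x hx t
  obtain ⟨y, k, hk, hy⟩ := hx t
  have hp := pow_pos (base_pos n) t
  have hstep : ∀ s, k (s + 1) = k s + ((n : ℤ) + 1) ^ t := by
    intro s
    have h1 := congrArg List.length (hy s)
    rw [word_length, power_length] at h1
    have h2 : ((k (s + 1) - k s).toNat : ℤ) = ((n : ℤ) + 1) ^ t := by exact_mod_cast h1
    omega
  have hks : ∀ s : ℤ, k s = k 0 + ((n : ℤ) + 1) ^ t * s := by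
    intro s
    induction s with
    | zero => simp
    | succ s ih =>
      rw [hstep, ih]
      ring
    | pred s ih =>
      have := hstep (-s - 1)
      rw [sub_add_cancel, ih] at this
      linear_combination -this
  -- The shift by `1` turns indices from `0` into offsets from `1`.
  refine ⟨k 0 - 1, fun v hv q r => ?_⟩
  set u := ((n : ℤ) + 1) ^ v * (((n : ℤ) + 1) * q + ((r : ℕ) + 1)) with hu
  set s := (u - 1) / ((n : ℤ) + 1) ^ t
  have h1 := Int.mul_ediv_add_emod (u - 1) (((n : ℤ) + 1) ^ t)
  have h2 := Int.emod_nonneg (u - 1) hp.ne'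
  have h3 := Int.emod_lt_of_pos (u - 1) hp
  obtain ⟨p, hpe⟩ : ∃ p : ℕ, (p : ℤ) = (u - 1) % ((n : ℤ) + 1) ^ t := ⟨_, Int.toNat_of_nonneg h2⟩
  rw [← hpe] at h1 h3
  obtain ⟨q', hq'⟩ := exists_digit_add hv q (-s) r
  have e1 := word_getElem? x (i := k s) (j := k (s + 1)) (l := p) (by rw [hstep]; omega)
  rw [hy s, power_getElem? (y s) r hv (by exact_mod_cast h3) (q := q')
    (by rw [← hq', ← hu]; linear_combination h1), hks] at e1
  have e2 : k 0 + ((n : ℤ) + 1) ^ t * s + p = k 0 - 1 + u := by linear_combination h1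
  rw [e2] at e1
  exact (Option.some.inj e1).symm

lemma phaseSet_subset_limitSet (n : ℕ) : phaseSet n ⊆ limitSet (prefixSubstitution n) := by
  intro x hx t
  obtain ⟨c, hc⟩ := hx t
  have hp := pow_pos (base_pos n) t
  -- Blocks end at the positions left open by the phase, and `y s` is the letter found there.
  refine ⟨fun s => x (c + ((n : ℤ) + 1) ^ t * (s + 1)), fun s => c + 1 + ((n : ℤ) + 1) ^ t * s,
    strictMono_int_of_lt_succ fun s => by nlinarith, fun s => ?_⟩
  have hlen : c + 1 + ((n : ℤ) + 1) ^ t * (s + 1) - (c + 1 + ((n : ℤ) + 1) ^ t * s) =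
    ((n : ℤ) + 1) ^ t := by ring
  refine List.ext_getElem? fun l => ?_
  by_cases hl : l < (n + 1) ^ t
  · have hl' : (l : ℤ) < ((n : ℤ) + 1) ^ t := by exact_mod_cast hl
    rw [word_getElem? _ (by rw [hlen]; exact hl')]
    rcases dvd_or_eq_digit n t (l + 1) with hd | ⟨v, hv, q, r, hd⟩
    · have h1 : (l : ℤ) + 1 = ((n : ℤ) + 1) ^ t :=
        le_antisymm hl' (Int.le_of_dvd (by positivity) hd)
      rw [power_getElem?_last _ (by exact_mod_cast h1)]
      congr 2
      linear_combination h1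
    · rw [power_getElem? _ r hv hl hd]
      obtain ⟨q', hq'⟩ := exists_digit_add hv q s r
      rw [← hc v hv q' r, ← hq', ← hd]
      congr 2
      ring
  · rw [List.getElem?_eq_none, List.getElem?_eq_none]
    · rw [power_length]
      omega
    · rw [word_length, hlen]
      have : ((n : ℤ) + 1) ^ t ≤ l := by exact_mod_cast not_lt.1 hl
      omega

/-! ### The language shift -/

lemma phaseSet_subset_languageShift (n : ℕ) : phaseSet n ⊆ languageShift (prefixSubstitution n) := by
  intro y hy i j
  obtain ⟨c₀, hc₀⟩ := hy (j - i).toNat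
  set t := (j - i).toNat with ht
  obtain ⟨c, h1, h2, hc⟩ := hc₀.exists_mem_window i
  have hlt : (t : ℤ) < ((n : ℤ) + 1) ^ t := by
    have := (y 0).2
    exact_mod_cast Nat.lt_pow_self (by omega : 1 < n + 1)
  refine ⟨t + 1, y 0, ?_⟩
  set M := ((n : ℤ) + 1) ^ t with hM
  have hyc : ((y c : ℕ) : ℤ) + 1 ≤ n := by have := (y c).2; omega
  have hy0 : (0 : ℤ) ≤ (y c : ℕ) := by positivity
  -- This `L` puts the open position `c` at index `M * (y c + 1) - 1`, whose letter in `τ^(t+1)` is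
  -- `y c`.
  obtain ⟨L, hL⟩ : ∃ L : ℕ, (L : ℤ) = M * ((y c : ℕ) + 1) + (i - c) - 1 :=
    ⟨_, Int.toNat_of_nonneg (by nlinarith)⟩
  refine isInfix_of_getElem? (L := L) fun l hl => ?_
  rw [word_length, ← ht] at hl
  rw [word_getElem? _ (by omega)]
  obtain ⟨v, hv, q', e⟩ := hc.exists_digit h1 h2 (l := i + l) (by omega) (by omega) 0
  refine power_getElem? _ _ hv ?_ (q := q') ?_
  · have : ((L + l : ℕ) : ℤ) < M * ((n : ℤ) + 1) := by
      push_cast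
      nlinarith
    rw [hM, ← pow_succ] at this
    exact_mod_cast this
  · rw [← e]
    push_cast
    linear_combination hL

lemma exists_phase_on_window {n t : ℕ} {x : ℤ → Fin n} (hx : x ∈ languageShift (prefixSubstitution n))
    {i j : ℤ} (hij : ((n : ℤ) + 1) ^ t ≤ j - i) :
    ∃ c, ∀ v < t, ∀ (q : ℤ) (r : Fin n), ∀ p : ℤ,
      p = c + ((n : ℤ) + 1) ^ v * (((n : ℤ) + 1) * q + ((r : ℕ) + 1)) →
      i ≤ p → p < j → x p = r := by
  obtain ⟨s, a, h⟩ := hx i j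
  have hts : t ≤ s := by
    have h1 := h.length_le
    rw [word_length, power_length] at h1
    have h2 : (n + 1) ^ t ≤ (j - i).toNat := by zify; omega
    have h3 := (x 0).2
    exact (Nat.pow_le_pow_iff_right (by omega : 1 < n + 1)).1 (h2.trans h1)
  obtain ⟨L, hL⟩ := exists_getElem?_of_isInfix h
  refine ⟨i - L - 1, fun v hv q r p hp hip hpj => ?_⟩
  obtain ⟨l, hl⟩ : ∃ l : ℕ, (l : ℤ) = p - i := ⟨_, Int.toNat_of_nonneg (by omega)⟩
  have h1 := hL l (by rw [word_length]; omega)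
  rw [word_getElem? x (by omega)] at h1
  have h2 : L + l < (n + 1) ^ s := by
    rw [← power_length n s a]
    exact (List.getElem?_eq_some_iff.1 h1).1
  rw [power_getElem? (q := q) a r (hv.trans_le hts) h2 (by push_cast; linear_combination hl + hp)] at h1
  have e : i + (l : ℤ) = p := by omega
  rw [e] at h1
  exact (Option.some.inj h1).symm

/-- Compactness by hand: if all `M` residues failed as phases, their failures would lie in a common
finite window, which nevertheless has a phase. -/
lemma languageShift_subset_phaseSet (n : ℕ) : languageShift (prefixSubstitution n) ⊆ phaseSet n := by
  intro x hx t
  by_contra! hcon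
  have hbad : ∀ c, ∃ p : ℤ, ∃ v < t, ∃ (q : ℤ) (r : Fin n),
      p = c + ((n : ℤ) + 1) ^ v * (((n : ℤ) + 1) * q + ((r : ℕ) + 1)) ∧ x p ≠ r := by
    intro c
    have := hcon c
    simp only [HasPhase, not_forall] at this
    obtain ⟨v, hv, q, r, h⟩ := this
    exact ⟨_, v, hv, q, r, rfl, h⟩
  choose p hp using hbad
  set M := ((n : ℤ) + 1) ^ t with hM
  have hMpos : 0 < M := pow_pos (base_pos n) t
  obtain ⟨B, hB⟩ := ((Finset.Ico (0 : ℤ) M).image fun c => |p c|).bddAbove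
  have hB' : ∀ c, 0 ≤ c → c < M → |p c| ≤ B := fun c h0 h1 =>
    hB (Finset.mem_coe.2 (Finset.mem_image_of_mem (fun c => |p c|) (Finset.mem_Ico.2 ⟨h0, h1⟩)))
  have hB0 : 0 ≤ B := (abs_nonneg _).trans (hB' 0 le_rfl hMpos)
  -- The extra `M` on the right makes the window long enough for level `t`.
  obtain ⟨c, hc⟩ := exists_phase_on_window hx (t := t) (i := -B) (j := B + 1 + M) (by omega)
  have h0 := Int.emod_nonneg c hMpos.ne'
  have h1 := Int.emod_lt_of_pos c hMpos
  obtain ⟨v, hv, q, r, h2, h3⟩ := hp (c % M)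
  have h4 := abs_le.1 (hB' _ h0 h1)
  obtain ⟨q', hq'⟩ := exists_digit_add hv q (-(c / M)) r
  refine h3 (hc v hv q' r _ ?_ h4.1 (by omega))
  rw [h2, ← hq', ← hM]
  linear_combination Int.mul_ediv_add_emod c M

end SubstShift

theorem mainTheorem8 (n : ℕ) (hn : 2 ≤ n) :
    SubstShift.IsToeplitzSubstitution (SubstShift.prefixSubstitution n) ∧
    ∃ X : SymbolicDynamics.FullShift.Subshift (Fin n) ℤ,
      X.carrier = SubstShift.limitSet (SubstShift.prefixSubstitution n) ∧
      X.carrier = SubstShift.languageShift (SubstShift.prefixSubstitution n) ∧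
      SubstShift.IsMinimalSystem (SubstShift.shiftMap X) ∧
      ∀ d : MetricSpace X.carrier,
        d.toPseudoMetricSpace.toUniformSpace.toTopologicalSpace = instTopologicalSpaceSubtype →
          @SubstShift.IsPositivelyExpansive X.carrier d n (SubstShift.shiftMap X) ∧
          ¬ @SubstShift.IsPositivelyExpansive X.carrier d (n - 1) (SubstShift.shiftMap X) := by
  refine ⟨SubstShift.isToeplitzSubstitution_prefixSubstitution (by omega),
    SubstShift.phaseShift n, ?_, ?_, SubstShift.isMinimalSystem_phaseShift (by omega),
    fun d hd => ⟨SubstShift.isPositivelyExpansive_phaseShift hn d hd,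
      SubstShift.not_isPositivelyExpansive_phaseShift (by omega) d hd⟩⟩
  · exact (SubstShift.phaseSet_subset_limitSet n).antisymm (SubstShift.limitSet_subset_phaseSet n)
  · exact (SubstShift.phaseSet_subset_languageShift n).antisymm
      (SubstShift.languageShift_subset_phaseSet n)
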